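/- Let $A_0\in\mathbb R^{n\times n}$ and $B\in\mathbb R^{n\times m}$ be such that $(A_0,B)$ is controllable and $A_0$ has no zero or purely imaginary eigenvalues. Let $D_J=\operatorname{diag}(D_{J_r},D_{J_\ell})$ be the real Jordan form of $A_0^T$ (or, more generally, any real block-diagonal matrix similar to $A_0^T$), where $D_{J_r}\in\mathbb R^{k\times k}$ has all its eigenvalues in the open right half plane and $D_{J_\ell}\in\mathbb R^{(n-k)\times(n-k)}$ has all its eigenvalues in the open left half plane. Let $L\in\mathbb R^{n\times n}$ be invertible with $A_0^TL=LD_J$, and put $M=L^TBB^TL=\begin{bmatrix}M_{11}&M_{12}\\M_{12}^T&M_{22}\end{bmatrix}$. All solutions are real symmetric matrices, and $X\le Y$ means that $Y-X$ is positive semidefinite. There are a unique rank-$k$ solution $\mathcal L_r$ of $-D_{J_r}\mathcal L-\mathcal LD_{J_r}^T+\mathcal LM_{11}\mathcal L=0$ and a unique rank-$(n-k)$ solution $\mathcal L_\ell$ of $-D_{J_\ell}\mathcal L-\mathcal LD_{J_\ell}^T+\mathcal LM_{22}\mathcal L=0$, and $\mathcal L_r^*=\operatorname{diag}(\mathcal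 L_r,0)$ and $\mathcal L_\ell^*=\operatorname{diag}(0,\mathcal L_\ell)$ are solutions of the simplified algebraic Riccati equation (ARE) $$-D_J\mathcal L-\mathcal LD_J^T+\mathcal LM\mathcal L=0.$$ Let $\mathcal L^*=\begin{bmatrix}L_{11}&L_{12}\\L_{12}^T&L_{22}\end{bmatrix}$ be any solution of maximal rank of this ARE. Its blocks $L_{11}$ and $L_{22}$ are both invertible if and only if $\mathcal L^*$ is invertible, and $\mathcal L^*$ is invertible if $A_0$ has no two eigenvalues $\mu,-\mu$. If $L_{11}$ and $L_{22}$ are invertible, then $\mathcal L_r^*$ and $\mathcal L_\ell^*$ are given by the Schur complements of $\mathcal L^*$ with respect to its left and right modes: $\mathcal L_r=L_{11}-L_{12}L_{22}^{-1}L_{12}^T$ and $\mathcal L_\ell=L_{22}-L_{12}^TL_{11}^{-1}L_{12}$. Every solution $\hat{\mathcal L}$ of the simplified algebraic Riccati inequality $-D_J\mathcal L-\mathcal LD_J^T+\mathcal LM\mathcal L\le 0$ satisfies $$\mathcal L_\ell^*\le\hat{\mathcal L}\le\mathcal L_r^*.$$ Consequently (Willems), if $Q=Q^T$, $K_0=K_0^T$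 solves $-A^TK-KA-Q+KBB^TK=0$ and $A_0=A-BB^TK_0$, then $K_{\min}=K_0+L\mathcal L_\ell^*L^T$ and $K_{\max}=K_0+L\mathcal L_r^*L^T$ solve this equation, and every symmetric $K$ with $-A^TK-KA-Q+KBB^TK\le0$ satisfies $K_{\min}\le K\le K_{\max}$. -/

import Mathlib

open Matrix
open scoped MatrixOrder

namespace Riccati

variable {ι : Type*} [Fintype ι] [DecidableEq ι]

/-- The Kalman controllability matrix `[B, A B, A² B, …, Aⁿ⁻¹ B]`; its columns are indexed by
the pairs (power of `A`, column of `B`). -/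
def controllabilityMatrix {n m : ℕ} (A : Matrix (Fin n) (Fin n) ℝ) (B : Matrix (Fin n) (Fin m) ℝ) :
    Matrix (Fin n) (Fin n × Fin m) ℝ :=
  Matrix.of fun i p => (A ^ (p.1 : ℕ) * B) i p.2

/-- The pair `(A, B)` is controllable: the controllability matrix has full row rank. -/
def Controllable {n m : ℕ} (A : Matrix (Fin n) (Fin n) ℝ) (B : Matrix (Fin n) (Fin m) ℝ) : Prop :=
  (controllabilityMatrix A B).rank = n

/-- The set of all complex eigenvalues of a real square matrix. -/
def eigenvalues (A : Matrix ι ι ℝ) : Set ℂ :=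
  spectrum ℂ (A.map (algebraMap ℝ ℂ))

/-- The expression `-D 𝓛 - 𝓛 Dᵀ + 𝓛 M 𝓛`. -/
def simplifiedRic (D M L : Matrix ι ι ℝ) : Matrix ι ι ℝ :=
  -D * L - L * Dᵀ + L * M * L

/-- `L` is a real symmetric solution of the simplified equation `-D 𝓛 - 𝓛 Dᵀ + 𝓛 M 𝓛 = 0`. -/
def IsSimplifiedARESolution (D M L : Matrix ι ι ℝ) : Prop :=
  L.IsSymm ∧ simplifiedRic D M L = 0

/-- `L` is a real symmetric solution of the simplified inequality `-D 𝓛 - 𝓛 Dᵀ + 𝓛 M 𝓛 ≤ 0`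
(in the Loewner order: `X ≤ Y` means that `Y - X` is positive semidefinite). -/
def IsSimplifiedARISolution (D M L : Matrix ι ι ℝ) : Prop :=
  L.IsSymm ∧ simplifiedRic D M L ≤ 0

/-- `L` is a solution of the simplified equation whose rank is maximal among all its solutions. -/
def IsMaximalRankARESolution (D M L : Matrix ι ι ℝ) : Prop :=
  IsSimplifiedARESolution D M L ∧
    ∀ L' : Matrix ι ι ℝ, IsSimplifiedARESolution D M L' → L'.rank ≤ L.rank

/-- `diag(L₁₁ - L₁₂ L₂₂⁻¹ L₂₁, 0)`: the Schur complement of `L` with respect to the `(2,2)` block,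
extended by zero. It is meaningful when `L₂₂` is invertible. -/
noncomputable def schurRight {k l : ℕ} (L : Matrix (Fin k ⊕ Fin l) (Fin k ⊕ Fin l) ℝ) :
    Matrix (Fin k ⊕ Fin l) (Fin k ⊕ Fin l) ℝ :=
  fromBlocks (L.toBlocks₁₁ - L.toBlocks₁₂ * L.toBlocks₂₂⁻¹ * L.toBlocks₂₁) 0 0 0

/-- `diag(0, L₂₂ - L₂₁ L₁₁⁻¹ L₁₂)`: the Schur complement of `L` with respect to the `(1,1)` block,
extended by zero. It is meaningful when `L₁₁` is invertible. -/
noncomputable def schurLeft {k l : ℕ} (L : Matrix (Fin k ⊕ Fin l) (Fin k ⊕ Fin l) ℝ) :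
    Matrix (Fin k ⊕ Fin l) (Fin k ⊕ Fin l) ℝ :=
  fromBlocks 0 0 0 (L.toBlocks₂₂ - L.toBlocks₂₁ * L.toBlocks₁₁⁻¹ * L.toBlocks₁₂)

/-- The expression `-Aᵀ K - K A - Q + K B Bᵀ K`. -/
def ric {n m : ℕ} (A : Matrix (Fin n) (Fin n) ℝ) (B : Matrix (Fin n) (Fin m) ℝ)
    (Q K : Matrix (Fin n) (Fin n) ℝ) : Matrix (Fin n) (Fin n) ℝ :=
  -Aᵀ * K - K * A - Q + K * B * Bᵀ * K

end Riccati

namespace Riccati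

set_option linter.unusedSectionVars false

variable {ι κ : Type*} [Fintype ι] [DecidableEq ι] [Fintype κ] [DecidableEq κ]

/-! ### Eigenvalues -/

/-! Inversion linearises the equation: an invertible `X` solves it iff `Y = X⁻¹` solves the Lyapunov
equation `Dᵀ Y + Y D = M` (`simplifiedRic_eq_zero_iff`). For `D = diag(Dr, Dl)` this splits into
four Sylvester equations. The two diagonal ones are uniquely solvable because each block has its
spectrum in one open half plane; controllability makes their solutions definite
(`posDef_of_lyapunov_of_observable`), namely `P > 0` and `-R < 0`. Hence `Lr = P⁻¹` and `Ll = -R⁻¹`.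

The inverse of every invertible solution has diagonal blocks `P` and `-R`, and a Schur complement is
the inverse of a diagonal block of the inverse; this gives the Schur formulas. If no two eigenvalues
are opposite, the off-diagonal equations are solvable too, so an invertible solution exists and
maximal rank means full rank.

For the bounds, the difference of the extremal solution and a solution of the inequality satisfies a
Lyapunov inequality for the closed loop, whose spectrum lies in one open half plane
(`le_of_antistable`). The congruence by `S` carries everything to the inhomogeneous equation
(`ric_add_conj`). -/

theorem mem_eigenvalues_iff_aeval_charpoly {A : Matrix ι ι ℝ} {μ : ℂ} :
    μ ∈ eigenvalues A ↔ Polynomial.aeval μ A.charpoly = 0 := by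
  rw [eigenvalues, mem_spectrum_iff_isRoot_charpoly, charpoly_map, Polynomial.IsRoot.def,
    Polynomial.eval_map_algebraMap]

theorem mem_eigenvalues_iff_exists_mulVec {A : Matrix ι ι ℝ} {μ : ℂ} :
    μ ∈ eigenvalues A ↔ ∃ v ≠ 0, A.map (algebraMap ℝ ℂ) *ᵥ v = μ • v := by
  rw [eigenvalues, spectrum.mem_iff, isUnit_iff_isUnit_det, isUnit_iff_ne_zero, not_not,
    ← exists_mulVec_eq_zero_iff]
  refine exists_congr fun v => and_congr_right fun _ => ?_
  rw [sub_mulVec, sub_eq_zero, Algebra.algebraMap_eq_smul_one, smul_mulVec, one_mulVec]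
  exact eq_comm

theorem eigenvalues_congr {A : Matrix ι ι ℝ} {B : Matrix κ κ ℝ} (h : A.charpoly = B.charpoly) :
    eigenvalues A = eigenvalues B := by
  ext μ
  rw [mem_eigenvalues_iff_aeval_charpoly, mem_eigenvalues_iff_aeval_charpoly, h]

theorem eigenvalues_transpose (A : Matrix ι ι ℝ) : eigenvalues Aᵀ = eigenvalues A :=
  eigenvalues_congr A.charpoly_transpose

theorem mem_eigenvalues_neg {A : Matrix ι ι ℝ} {μ : ℂ} :
    μ ∈ eigenvalues (-A) ↔ -μ ∈ eigenvalues A := by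
  simp only [mem_eigenvalues_iff_exists_mulVec]
  refine exists_congr fun v => and_congr_right fun _ => ?_
  have : (-A).map (algebraMap ℝ ℂ) = -(A.map (algebraMap ℝ ℂ)) := by ext; simp
  rw [this, neg_mulVec, neg_smul, neg_eq_iff_eq_neg]

theorem eigenvalues_eq_of_conj {A : Matrix ι ι ℝ} {B : Matrix κ κ ℝ} {S : Matrix ι κ ℝ}
    {T : Matrix κ ι ℝ} (hST : S * T = 1) (hTS : T * S = 1) (h : A * S = S * B) :
    eigenvalues A = eigenvalues B := by
  have hA : A = S * B * T := by rw [← h, Matrix.mul_assoc, hST, Matrix.mul_one]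
  have hST' : S.map (algebraMap ℝ ℂ) * T.map (algebraMap ℝ ℂ) = 1 := by
    rw [← Matrix.map_mul, hST]; simp
  have hTS' : T.map (algebraMap ℝ ℂ) * S.map (algebraMap ℝ ℂ) = 1 := by
    rw [← Matrix.map_mul, hTS]; simp
  ext μ
  simp only [eigenvalues, spectrum.mem_iff, isUnit_iff_isUnit_det]
  have key : algebraMap ℂ (Matrix ι ι ℂ) μ - A.map (algebraMap ℝ ℂ) =
      S.map (algebraMap ℝ ℂ) * (algebraMap ℂ (Matrix κ κ ℂ) μ - B.map (algebraMap ℝ ℂ)) *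
        T.map (algebraMap ℝ ℂ) := by
    rw [hA, Matrix.map_mul, Matrix.map_mul, Matrix.mul_sub, Matrix.sub_mul,
      Algebra.algebraMap_eq_smul_one, Algebra.algebraMap_eq_smul_one, Matrix.mul_smul,
      Matrix.smul_mul, Matrix.mul_one, hST']
  rw [key, det_conj_of_mul_eq_one hST' hTS']

theorem mem_eigenvalues_fromBlocks_zero₁₂ {A : Matrix ι ι ℝ} {C : Matrix κ ι ℝ} {B : Matrix κ κ ℝ}
    {μ : ℂ} :
    μ ∈ eigenvalues (fromBlocks A 0 C B) ↔ μ ∈ eigenvalues A ∨ μ ∈ eigenvalues B := by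
  simp only [mem_eigenvalues_iff_aeval_charpoly, charpoly_fromBlocks_zero₁₂, map_mul,
    mul_eq_zero]

theorem mem_eigenvalues_fromBlocks_zero₂₁ {A : Matrix ι ι ℝ} {C : Matrix ι κ ℝ} {B : Matrix κ κ ℝ}
    {μ : ℂ} :
    μ ∈ eigenvalues (fromBlocks A C 0 B) ↔ μ ∈ eigenvalues A ∨ μ ∈ eigenvalues B := by
  simp only [mem_eigenvalues_iff_aeval_charpoly, charpoly_fromBlocks_zero₂₁, map_mul,
    mul_eq_zero]

/-- Without a common complex root the characteristic polynomials are coprime. Evaluating a Bézout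
identity at `A` kills one term by Cayley–Hamilton and exhibits an inverse. -/
theorem isUnit_aeval_charpoly {A : Matrix ι ι ℝ} {B : Matrix κ κ ℝ}
    (h : ∀ μ ∈ eigenvalues A, μ ∉ eigenvalues B) :
    IsUnit (Polynomial.aeval A B.charpoly) := by
  have hc : IsCoprime A.charpoly B.charpoly := by
    rw [Polynomial.isCoprime_iff_aeval_ne_zero_of_isAlgClosed ℝ ℂ]
    intro μ
    by_contra! hμ
    exact h μ (mem_eigenvalues_iff_aeval_charpoly.2 hμ.1)
      (mem_eigenvalues_iff_aeval_charpoly.2 hμ.2)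
  obtain ⟨u, w, huw⟩ := hc
  have := congrArg (Polynomial.aeval A) huw
  simp only [map_add, map_mul, aeval_self_charpoly, mul_zero, zero_add, map_one] at this
  exact IsUnit.of_mul_eq_one_right _ this

/-! ### The Sylvester equation -/

/-- The Sylvester operator `Y ↦ A Y + Y B`. -/
def sylvester (A : Matrix ι ι ℝ) (B : Matrix κ κ ℝ) : Matrix ι κ ℝ →ₗ[ℝ] Matrix ι κ ℝ where
  toFun Y := A * Y + Y * B
  map_add' X Y := by simp only [Matrix.mul_add, Matrix.add_mul]; abel
  map_smul' c X := by simp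

theorem sylvester_apply (A : Matrix ι ι ℝ) (B : Matrix κ κ ℝ) (Y : Matrix ι κ ℝ) :
    sylvester A B Y = A * Y + Y * B := rfl

theorem aeval_mul_comm {A : Matrix ι ι ℝ} {B : Matrix κ κ ℝ} {Y : Matrix ι κ ℝ}
    (h : A * Y = Y * B) (p : Polynomial ℝ) :
    Polynomial.aeval A p * Y = Y * Polynomial.aeval B p := by
  induction p using Polynomial.induction_on' with
  | add p q hp hq => simp only [map_add, Matrix.add_mul, Matrix.mul_add, hp, hq]
  | monomial k a =>
    have hk : A ^ k * Y = Y * B ^ k := by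
      induction k with
      | zero => simp
      | succ k ih => rw [pow_succ, Matrix.mul_assoc, h, ← Matrix.mul_assoc, ih, Matrix.mul_assoc,
          ← pow_succ]
    simp only [Polynomial.aeval_monomial, Algebra.algebraMap_eq_smul_one, Matrix.smul_mul,
      Matrix.mul_smul, Matrix.one_mul, hk]

/-- If `A Y = Y (-B)`, then `p(A) Y = Y p(-B)` for every polynomial `p`. For the characteristic
polynomial of `-B` the right side vanishes while `p(A)` is invertible. -/
theorem sylvester_injective {A : Matrix ι ι ℝ} {B : Matrix κ κ ℝ}
    (h : ∀ μ ∈ eigenvalues A, -μ ∉ eigenvalues B) : Function.Injective (sylvester A B) := by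
  rw [injective_iff_map_eq_zero]
  intro Y hY
  rw [sylvester_apply, add_eq_zero_iff_eq_neg, ← Matrix.mul_neg] at hY
  obtain ⟨U, hU⟩ := isUnit_aeval_charpoly (B := -B) fun μ hμ => by
    rw [mem_eigenvalues_neg]; exact h μ hμ
  have h0 : (U : Matrix ι ι ℝ) * Y = 0 := by
    rw [hU, aeval_mul_comm hY, aeval_self_charpoly, Matrix.mul_zero]
  calc Y = ((U⁻¹ : (Matrix ι ι ℝ)ˣ) : Matrix ι ι ℝ) * ((U : Matrix ι ι ℝ) * Y) := by
        rw [← Matrix.mul_assoc, Units.inv_mul, Matrix.one_mul]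
    _ = 0 := by rw [h0, Matrix.mul_zero]

theorem sylvester_surjective {A : Matrix ι ι ℝ} {B : Matrix κ κ ℝ}
    (h : ∀ μ ∈ eigenvalues A, -μ ∉ eigenvalues B) : Function.Surjective (sylvester A B) :=
  LinearMap.injective_iff_surjective.1 (sylvester_injective h)

/-! ### The Lyapunov equation -/

/-- All eigenvalues lie in the open right half plane. -/
def Antistable (D : Matrix ι ι ℝ) : Prop := ∀ μ ∈ eigenvalues D, 0 < μ.re

theorem Antistable.neg_notMem {D : Matrix ι ι ℝ} (hD : Antistable D) :
    ∀ μ ∈ eigenvalues Dᵀ, -μ ∉ eigenvalues D := by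
  intro μ hμ hμ'
  rw [eigenvalues_transpose] at hμ
  have h1 := hD _ hμ
  have h2 := hD _ hμ'
  rw [Complex.neg_re] at h2
  linarith

/-- The eigenvalues are `(1 - t) + t ν` with `ν` an eigenvalue of `D`. This makes the segment from
`1` to `D` a homotopy for Lyapunov's theorem. -/
theorem Antistable.convex_one {D : Matrix ι ι ℝ} (hD : Antistable D) {t : ℝ} (h0 : 0 ≤ t)
    (h1 : t ≤ 1) : Antistable ((1 - t) • (1 : Matrix ι ι ℝ) + t • D) := by
  intro μ hμ
  obtain ⟨v, hv, h⟩ := mem_eigenvalues_iff_exists_mulVec.1 hμ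
  have hmap : ((1 - t) • (1 : Matrix ι ι ℝ) + t • D).map (algebraMap ℝ ℂ) =
      (1 - t : ℂ) • (1 : Matrix ι ι ℂ) + (t : ℂ) • D.map (algebraMap ℝ ℂ) := by
    ext i j
    by_cases hij : i = j <;> simp [hij]
  rw [hmap, add_mulVec, smul_mulVec, smul_mulVec, one_mulVec] at h
  rcases h0.eq_or_lt with rfl | ht
  · simp only [Complex.ofReal_zero, sub_zero, one_smul, zero_smul, add_zero] at h
    have : (1 - μ) • v = 0 := by rw [sub_smul, one_smul, ← h, sub_self]
    rcases smul_eq_zero.1 this with h' | h'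
    · rw [← sub_eq_zero.1 h']; simp
    · exact absurd h' hv
  · have ht' : (t : ℂ) ≠ 0 := by exact_mod_cast ht.ne'
    have hν : D.map (algebraMap ℝ ℂ) *ᵥ v = ((μ - (1 - t)) / t) • v := by
      have : (t : ℂ) • (D.map (algebraMap ℝ ℂ) *ᵥ v) = (μ - (1 - t)) • v := by
        rw [sub_smul, ← h]; abel
      rw [div_eq_inv_mul, mul_smul, ← this, smul_smul, inv_mul_cancel₀ ht', one_smul]
    have hre := hD _ (mem_eigenvalues_iff_exists_mulVec.2 ⟨v, hv, hν⟩)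
    rw [Complex.div_ofReal_re, div_pos_iff_of_pos_right ht] at hre
    simp only [Complex.sub_re, Complex.one_re, Complex.ofReal_re] at hre
    linarith

/-- The transpose of `X` solves the same uniquely solvable equation. -/
theorem isSymm_of_lyapunov {D X N : Matrix ι ι ℝ} (hD : Antistable D) (hN : N.IsSymm)
    (h : Dᵀ * X + X * D = N) : X.IsSymm := by
  refine sylvester_injective hD.neg_notMem ?_
  rw [sylvester_apply, sylvester_apply, h, ← hN.eq, ← h]
  simp [add_comm]

theorem isHermitian_of_isSymm {X : Matrix ι ι ℝ} (hX : X.IsSymm) : X.IsHermitian := by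
  rw [IsHermitian, conjTranspose_eq_transpose_of_trivial]; exact hX

theorem dotProduct_lyapunov_mulVec {D X : Matrix ι ι ℝ} (hX : X.IsSymm) (v : ι → ℝ) :
    v ⬝ᵥ (Dᵀ * X + X * D) *ᵥ v = 2 * ((X *ᵥ v) ⬝ᵥ (D *ᵥ v)) := by
  rw [add_mulVec, dotProduct_add, ← mulVec_mulVec, ← mulVec_mulVec, dotProduct_mulVec v Dᵀ,
    vecMul_transpose, dotProduct_mulVec v X, ← mulVec_transpose, hX.eq,
    dotProduct_comm (D *ᵥ v)]
  ring

theorem posDef_of_forall_sphere {X : Matrix ι ι ℝ} (hX : X.IsSymm)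
    (h : ∀ v ∈ Metric.sphere (0 : ι → ℝ) 1, 0 < v ⬝ᵥ X *ᵥ v) : X.PosDef := by
  refine PosDef.of_dotProduct_mulVec_pos (isHermitian_of_isSymm hX) fun v hv => ?_
  have hn : 0 < ‖v‖ := norm_pos_iff.2 hv
  have := h (‖v‖⁻¹ • v) (by simp [norm_smul, hn.ne'])
  rw [mulVec_smul, dotProduct_smul, smul_dotProduct, smul_eq_mul, smul_eq_mul] at this
  rw [star_trivial]
  have hi : 0 < ‖v‖⁻¹ := inv_pos.2 hn
  exact pos_of_mul_pos_right (pos_of_mul_pos_right this hi.le) hi.le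

/-- The matrix of the Lyapunov operator is affine in `t` and invertible on `[0, 1]`, so Cramer's
rule gives a continuous inverse. -/
theorem exists_continuousOn_lyapunov {D : Matrix ι ι ℝ} (hD : Antistable D) (N : Matrix ι ι ℝ) :
    ∃ X : ℝ → Matrix ι ι ℝ, ContinuousOn X (Set.Icc 0 1) ∧ ∀ t ∈ Set.Icc (0 : ℝ) 1,
      ((1 - t) • (1 : Matrix ι ι ℝ) + t • D)ᵀ * X t +
        X t * ((1 - t) • (1 : Matrix ι ι ℝ) + t • D) = N := by
  let b := Matrix.stdBasis ℝ ι ι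
  let E : ℝ → Matrix ι ι ℝ := fun t => (1 - t) • (1 : Matrix ι ι ℝ) + t • D
  let N₀ := LinearMap.toMatrix b b (sylvester (1 : Matrix ι ι ℝ)ᵀ (1 : Matrix ι ι ℝ))
  let N₁ := LinearMap.toMatrix b b (sylvester Dᵀ D)
  have hE : ∀ t, LinearMap.toMatrix b b (sylvester (E t)ᵀ (E t)) = (1 - t) • N₀ + t • N₁ := by
    intro t
    simp only [N₀, N₁, ← map_smul, ← map_add]
    congr 1
    ext1 Y
    simp only [E, sylvester_apply, LinearMap.add_apply, LinearMap.smul_apply, transpose_add,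
      transpose_smul, Matrix.add_mul, Matrix.mul_add, Matrix.smul_mul, Matrix.mul_smul, smul_add]
    abel
  have hdet : ∀ t ∈ Set.Icc (0 : ℝ) 1, IsUnit ((1 - t) • N₀ + t • N₁).det := by
    intro t ht
    rw [← hE, ← isUnit_iff_isUnit_det]
    have hinj := sylvester_injective (hD.convex_one ht.1 ht.2).neg_notMem
    have hu : IsUnit (sylvester (E t)ᵀ (E t)) := by
      rw [LinearMap.isUnit_iff_ker_eq_bot]
      exact LinearMap.ker_eq_bot.2 hinj
    exact hu.map (LinearMap.toMatrixAlgEquiv b)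
  let ev : Matrix (ι × ι) (ι × ι) ℝ →ₗ[ℝ] Matrix ι ι ℝ :=
    (LinearMap.applyₗ N).comp (Matrix.toLin b b).toLinearMap
  refine ⟨fun t => ev ((1 - t) • N₀ + t • N₁)⁻¹, ?_, fun t ht => ?_⟩
  · refine (LinearMap.continuous_of_finiteDimensional ev).comp_continuousOn ?_
    have hc : Continuous fun t : ℝ => (1 - t) • N₀ + t • N₁ := by fun_prop
    simp only [Matrix.inv_def, Ring.inverse_eq_inv']
    exact ContinuousOn.smul (hc.matrix_det.continuousOn.inv₀ fun t ht => (hdet t ht).ne_zero)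
      hc.matrix_adjugate.continuousOn
  · have : sylvester (E t)ᵀ (E t) (ev ((1 - t) • N₀ + t • N₁)⁻¹) = N := by
      have h1 : sylvester (E t)ᵀ (E t) = Matrix.toLin b b ((1 - t) • N₀ + t • N₁) := by
        rw [← hE, Matrix.toLin_toMatrix]
      simp only [ev, LinearMap.comp_apply, LinearEquiv.coe_coe, LinearMap.applyₗ_apply_apply]
      rw [h1, ← LinearMap.comp_apply, ← Matrix.toLin_mul, Matrix.mul_nonsing_inv _ (hdet t ht),
        Matrix.toLin_one, LinearMap.id_apply]
    exact this

/-- Lyapunov's theorem, with a positive definite right-hand side. -/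
theorem posDef_of_lyapunov {D X N : Matrix ι ι ℝ} (hD : Antistable D) (hN : N.PosDef)
    (h : Dᵀ * X + X * D = N) : X.PosDef := by
  obtain ⟨Y, hYc, hY⟩ := exists_continuousOn_lyapunov hD N
  have hNs : N.IsSymm := by
    have := hN.isHermitian
    rwa [IsHermitian, conjTranspose_eq_transpose_of_trivial] at this
  have hYs : ∀ t ∈ Set.Icc (0 : ℝ) 1, (Y t).IsSymm := fun t ht =>
    isSymm_of_lyapunov (hD.convex_one ht.1 ht.2) hNs (hY t ht)
  have hY1 : Y 1 = X := by
    have := hY 1 (by simp)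
    simp only [sub_self, zero_smul, one_smul, zero_add] at this
    exact sylvester_injective hD.neg_notMem (this.trans h.symm)
  -- At `t = 0` the equation reads `2 Y = N`.
  have hY0 : ∀ v ≠ 0, 0 < v ⬝ᵥ Y 0 *ᵥ v := by
    intro v hv
    have h0 := hY 0 (by simp)
    simp only [sub_zero, zero_smul, one_smul, add_zero, transpose_one, Matrix.one_mul,
      Matrix.mul_one] at h0
    have := hN.dotProduct_mulVec_pos hv
    rw [← h0, star_trivial, add_mulVec, dotProduct_add] at this
    linarith
  have hsph : ∀ v ∈ Metric.sphere (0 : ι → ℝ) 1, v ≠ 0 := fun v hv => by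
    rintro rfl; simp at hv
  let f : ℝ × (ι → ℝ) → ℝ := fun p => p.2 ⬝ᵥ Y p.1 *ᵥ p.2
  let R : Set (ℝ × (ι → ℝ)) := Set.Icc 0 1 ×ˢ Metric.sphere 0 1
  have hf : ContinuousOn f R := by
    have hY' : ContinuousOn (fun p : ℝ × (ι → ℝ) => Y p.1) R :=
      hYc.comp continuousOn_fst fun p hp => hp.1
    have hij : ∀ i j, ContinuousOn (fun p : ℝ × (ι → ℝ) => Y p.1 i j) R := fun i j =>
      (continuous_id.matrix_elem i j).comp_continuousOn hY'
    have hi : ∀ i, ContinuousOn (fun p : ℝ × (ι → ℝ) => p.2 i) R := fun i =>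
      ((continuous_apply i).comp continuous_snd).continuousOn
    exact continuousOn_finsetSum _ fun i _ =>
      (hi i).mul (continuousOn_finsetSum _ fun j _ => (hij i j).mul (hi j))
  have hRc : IsCompact R := isCompact_Icc.prod (isCompact_sphere 0 1)
  -- The compact set of times and unit vectors at which positivity fails. If it is nonempty, it has
  -- a point with least time.
  have hKc : IsCompact (R ∩ f ⁻¹' Set.Iic 0) :=
    hRc.of_isClosed_subset (hf.preimage_isClosed_of_isClosed hRc.isClosed isClosed_Iic)
      Set.inter_subset_left
  rcases (R ∩ f ⁻¹' Set.Iic 0).eq_empty_or_nonempty with hK | hK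
  · rw [← hY1]
    refine posDef_of_forall_sphere (hYs 1 (by simp)) fun v hv => ?_
    by_contra hle
    have : ((1 : ℝ), v) ∈ R ∩ f ⁻¹' Set.Iic 0 := ⟨⟨by simp, hv⟩, not_lt.1 hle⟩
    simp [hK] at this
  · exfalso
    obtain ⟨⟨t, v⟩, ⟨⟨ht, hv⟩, hle⟩, hmin⟩ := hKc.exists_isMinOn hK continuousOn_fst
    -- A negative value at the least time `t` would force a zero at some earlier time.
    have hpos : ∀ w ∈ Metric.sphere (0 : ι → ℝ) 1, 0 ≤ w ⬝ᵥ Y t *ᵥ w := by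
      intro w hw
      by_contra! hlt
      have hg : ContinuousOn (fun s => f (s, w)) (Set.Icc 0 t) :=
        hf.comp (by fun_prop) fun s hs => ⟨⟨hs.1, hs.2.trans ht.2⟩, hw⟩
      obtain ⟨s, hs, hs0⟩ := intermediate_value_Icc' ht.1 hg
        ⟨hlt.le, (hY0 w (hsph w hw)).le⟩
      have hts : t ≤ s := hmin (a := (s, w)) ⟨⟨⟨hs.1, hs.2.trans ht.2⟩, hw⟩, hs0.le⟩
      have : s = t := le_antisymm hs.2 hts
      rw [this] at hs0
      exact hlt.ne hs0
    have hpsd : (Y t).PosSemidef := by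
      refine PosSemidef.of_dotProduct_mulVec_nonneg (isHermitian_of_isSymm (hYs t ht)) fun w => ?_
      rw [star_trivial]
      rcases eq_or_ne w 0 with rfl | hw
      · simp
      have hn : 0 < ‖w‖ := norm_pos_iff.2 hw
      have := hpos (‖w‖⁻¹ • w) (by simp [norm_smul, hn.ne'])
      rw [mulVec_smul, dotProduct_smul, smul_dotProduct, smul_eq_mul, smul_eq_mul] at this
      have hi : 0 < ‖w‖⁻¹ := inv_pos.2 hn
      exact nonneg_of_mul_nonneg_right (nonneg_of_mul_nonneg_right this hi) hi
    -- A null vector of a semidefinite form lies in the kernel; the Lyapunov equation then gives `vᵀ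
    -- N v = 0`, against `N > 0`.
    have hv0 : Y t *ᵥ v = 0 := by
      rw [← hpsd.dotProduct_mulVec_zero_iff, star_trivial]
      exact le_antisymm hle (hpos v hv)
    have := hN.dotProduct_mulVec_pos (hsph v hv)
    rw [star_trivial, ← hY t ht, dotProduct_lyapunov_mulVec (hYs t ht), hv0, zero_dotProduct,
      mul_zero] at this
    exact this.false

/-- Lyapunov's theorem, with a positive semidefinite right-hand side. -/
theorem posSemidef_of_lyapunov {D X : Matrix ι ι ℝ} (hD : Antistable D)
    (h : (Dᵀ * X + X * D).PosSemidef) : X.PosSemidef := by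
  have hXs : X.IsSymm := by
    refine isSymm_of_lyapunov hD ?_ rfl
    have := h.isHermitian
    rwa [IsHermitian, conjTranspose_eq_transpose_of_trivial] at this
  -- Adding `ε • P` to `X` adds `ε • 1` to the right-hand side; the definite case applies, and then
  -- `ε → 0`.
  obtain ⟨P, hP⟩ := sylvester_surjective hD.neg_notMem 1
  rw [sylvester_apply] at hP
  have hε : ∀ ε : ℝ, 0 < ε → (X + ε • P).PosDef := by
    intro ε hε
    refine posDef_of_lyapunov hD (PosDef.posSemidef_add h (PosDef.one.smul hε)) ?_
    rw [← hP]
    simp only [Matrix.mul_add, Matrix.add_mul, Matrix.mul_smul, Matrix.smul_mul, smul_add]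
    abel
  refine PosSemidef.of_dotProduct_mulVec_nonneg (isHermitian_of_isSymm hXs) fun v => ?_
  rw [star_trivial]
  have hlim : Filter.Tendsto (fun ε : ℝ => v ⬝ᵥ X *ᵥ v + ε * (v ⬝ᵥ P *ᵥ v)) (nhdsWithin 0 (Set.Ioi 0))
      (nhds (v ⬝ᵥ X *ᵥ v + 0 * (v ⬝ᵥ P *ᵥ v))) :=
    (Continuous.tendsto (by fun_prop) 0).mono_left nhdsWithin_le_nhds
  rw [zero_mul, add_zero] at hlim
  refine ge_of_tendsto hlim (eventually_nhdsWithin_of_forall fun ε hε' => ?_)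
  have := (hε ε hε').posSemidef.dotProduct_mulVec_nonneg v
  rwa [star_trivial, add_mulVec, dotProduct_add, smul_mulVec, dotProduct_smul, smul_eq_mul] at this

theorem isSymm_of_isHermitian {X : Matrix ι ι ℝ} (hX : X.IsHermitian) : X.IsSymm := by
  rwa [IsHermitian, conjTranspose_eq_transpose_of_trivial] at hX

theorem range_mulVecLin_eq_top_of_rank {A : Matrix ι κ ℝ} (h : A.rank = Fintype.card ι) :
    LinearMap.range A.mulVecLin = ⊤ :=
  Submodule.eq_top_of_finrank_eq (by rw [Module.finrank_fintype_fun_eq_card]; exact h)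

theorem rank_eq_card_iff_isUnit {A : Matrix ι ι ℝ} : A.rank = Fintype.card ι ↔ IsUnit A := by
  refine ⟨fun h => ?_, fun h => rank_of_isUnit A h⟩
  rw [← mulVec_surjective_iff_isUnit]
  exact LinearMap.range_eq_top.1 (range_mulVecLin_eq_top_of_rank h)

/-! ### Observability -/

/-- The pair `(M, D)` is observable: no nonzero vector has all its `D`-iterates in `ker M`. -/
def Observable (D M : Matrix ι ι ℝ) : Prop :=
  ∀ v : ι → ℝ, (∀ j : ℕ, M *ᵥ (D ^ j *ᵥ v) = 0) → v = 0

theorem Observable.neg {D M : Matrix ι ι ℝ} (h : Observable D M) : Observable (-D) M := by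
  refine fun v hv => h v fun j => ?_
  have := hv j
  rcases neg_one_pow_eq_or (Matrix ι ι ℝ) j with hj | hj <;> rw [neg_pow, hj] at this
  · rwa [Matrix.one_mul] at this
  · rwa [Matrix.neg_mul, Matrix.one_mul, neg_mulVec, mulVec_neg, neg_eq_zero] at this

/-- Such a `w` is orthogonal to the columns of the controllability matrix, which span the whole
space. -/
theorem Controllable.eq_zero {n m : ℕ} {A : Matrix (Fin n) (Fin n) ℝ}
    {B : Matrix (Fin n) (Fin m) ℝ} (h : Controllable A B) {w : Fin n → ℝ}
    (hw : ∀ j : ℕ, Bᵀ *ᵥ (Aᵀ ^ j *ᵥ w) = 0) : w = 0 := by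
  have htop := range_mulVecLin_eq_top_of_rank (A := controllabilityMatrix A B)
    (by rw [Fintype.card_fin]; exact h)
  obtain ⟨u, hu⟩ : w ∈ LinearMap.range (controllabilityMatrix A B).mulVecLin := by
    rw [htop]; trivial
  have h0 : w ᵥ* controllabilityMatrix A B = 0 := by
    ext ⟨j, i⟩
    have := congrFun (hw j) i
    rw [mulVec_mulVec, ← transpose_pow, ← transpose_mul, mulVec_transpose] at this
    exact this
  have : w ⬝ᵥ w = 0 := by
    nth_rewrite 2 [← hu]
    rw [mulVecLin_apply, dotProduct_mulVec, h0, zero_dotProduct]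
  exact dotProduct_self_eq_zero.1 this

theorem Controllable.observable {n m : ℕ} {A : Matrix (Fin n) (Fin n) ℝ}
    {B : Matrix (Fin n) (Fin m) ℝ} (h : Controllable A B) {S : Matrix (Fin n) ι ℝ}
    {T : Matrix ι (Fin n) ℝ} (hTS : T * S = 1) {D : Matrix ι ι ℝ} (hS : Aᵀ * S = S * D) :
    Observable D (Sᵀ * B * Bᵀ * S) := by
  intro v hv
  have hpow : ∀ j : ℕ, Aᵀ ^ j * S = S * D ^ j := by
    intro j
    induction j with
    | zero => simp
    | succ j ih => rw [pow_succ, Matrix.mul_assoc, hS, ← Matrix.mul_assoc, ih, Matrix.mul_assoc,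
        ← pow_succ]
  have hSv : S *ᵥ v = 0 := by
    refine h.eq_zero fun j => ?_
    have hj := hv j
    -- A Gram matrix has the same kernel as its factor.
    have hM : Sᵀ * B * Bᵀ * S = (Bᵀ * S)ᴴ * (Bᵀ * S) := by
      rw [conjTranspose_eq_transpose_of_trivial, transpose_mul, transpose_transpose,
        Matrix.mul_assoc (Sᵀ * B)]
    rw [hM, conjTranspose_mul_self_mulVec_eq_zero] at hj
    rw [mulVec_mulVec _ _ S, hpow, mulVec_mulVec, ← Matrix.mul_assoc, ← mulVec_mulVec, hj]
  rw [← one_mulVec v, ← hTS, ← mulVec_mulVec, hSv, mulVec_zero]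

/-- For a semidefinite matrix the kernel is the null set of the quadratic form, which on such
vectors sees only the corner block. Observability thereby passes to the blocks. -/
theorem mulVec_eq_zero_of_inl {M : Matrix (ι ⊕ κ) (ι ⊕ κ) ℝ} (hM : M.PosSemidef) {v : ι → ℝ}
    (h : M.toBlocks₁₁ *ᵥ v = 0) : M *ᵥ Sum.elim v 0 = 0 := by
  rw [← hM.dotProduct_mulVec_zero_iff, star_trivial, ← fromBlocks_toBlocks M, fromBlocks_mulVec]
  simp [h]

theorem mulVec_eq_zero_of_inr {M : Matrix (ι ⊕ κ) (ι ⊕ κ) ℝ} (hM : M.PosSemidef) {v : κ → ℝ}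
    (h : M.toBlocks₂₂ *ᵥ v = 0) : M *ᵥ Sum.elim 0 v = 0 := by
  rw [← hM.dotProduct_mulVec_zero_iff, star_trivial, ← fromBlocks_toBlocks M, fromBlocks_mulVec]
  simp [h]

theorem fromBlocks_diag_pow_mulVec (A : Matrix ι ι ℝ) (B : Matrix κ κ ℝ) (v : ι → ℝ) (w : κ → ℝ)
    (j : ℕ) : fromBlocks A 0 0 B ^ j *ᵥ Sum.elim v w = Sum.elim (A ^ j *ᵥ v) (B ^ j *ᵥ w) := by
  induction j with
  | zero => simp
  | succ j ih => rw [pow_succ', ← mulVec_mulVec, ih, fromBlocks_mulVec]; simp [pow_succ']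

theorem Observable.toBlocks₁₁ {A : Matrix ι ι ℝ} {B : Matrix κ κ ℝ}
    {M : Matrix (ι ⊕ κ) (ι ⊕ κ) ℝ} (hM : M.PosSemidef) (h : Observable (fromBlocks A 0 0 B) M) :
    Observable A M.toBlocks₁₁ := by
  intro v hv
  have := h (Sum.elim v 0) fun j => by
    rw [fromBlocks_diag_pow_mulVec, mulVec_zero]
    exact mulVec_eq_zero_of_inl hM (hv j)
  ext i
  simpa using congrFun this (Sum.inl i)

theorem Observable.toBlocks₂₂ {A : Matrix ι ι ℝ} {B : Matrix κ κ ℝ}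
    {M : Matrix (ι ⊕ κ) (ι ⊕ κ) ℝ} (hM : M.PosSemidef) (h : Observable (fromBlocks A 0 0 B) M) :
    Observable B M.toBlocks₂₂ := by
  intro v hv
  have := h (Sum.elim 0 v) fun j => by
    rw [fromBlocks_diag_pow_mulVec, mulVec_zero]
    exact mulVec_eq_zero_of_inr hM (hv j)
  ext i
  simpa using congrFun this (Sum.inr i)

/-- Lyapunov's theorem for an observable pair. -/
theorem posDef_of_lyapunov_of_observable {D X M : Matrix ι ι ℝ} (hD : Antistable D)
    (hM : M.PosSemidef) (hobs : Observable D M) (h : Dᵀ * X + X * D = M) : X.PosDef := by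
  have hX : X.PosSemidef := posSemidef_of_lyapunov hD (h ▸ hM)
  have hXs := isSymm_of_isHermitian hX.isHermitian
  rw [hX.posDef_iff_isUnit, ← mulVec_injective_iff_isUnit, ← coe_mulVecLin,
    injective_iff_map_eq_zero]
  intro v hv
  rw [mulVecLin_apply] at hv
  -- The kernel of `X` is `D`-invariant and contained in that of `M`, hence trivial by
  -- observability.
  have hstep : ∀ w, X *ᵥ w = 0 → M *ᵥ w = 0 ∧ X *ᵥ (D *ᵥ w) = 0 := by
    intro w hw
    have hMw : M *ᵥ w = 0 := by
      rw [← hM.dotProduct_mulVec_zero_iff, star_trivial, ← h, dotProduct_lyapunov_mulVec hXs, hw,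
        zero_dotProduct, mul_zero]
    refine ⟨hMw, ?_⟩
    rw [← h, add_mulVec, ← mulVec_mulVec, hw, mulVec_zero, zero_add] at hMw
    rwa [mulVec_mulVec]
  have hX' : ∀ j : ℕ, X *ᵥ (D ^ j *ᵥ v) = 0 := by
    intro j
    induction j with
    | zero => simpa using hv
    | succ j ih => rw [pow_succ', ← mulVec_mulVec]; exact (hstep _ ih).2
  exact hobs v fun j => (hstep _ (hX' j)).1

/-! ### The simplified Riccati expression -/

theorem simplifiedRic_neg_neg (D M X : Matrix ι ι ℝ) :
    simplifiedRic (-D) M (-X) = simplifiedRic D M X := by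
  simp [simplifiedRic]

theorem IsSimplifiedARESolution.neg {D M X : Matrix ι ι ℝ} (h : IsSimplifiedARESolution D M X) :
    IsSimplifiedARESolution (-D) M (-X) :=
  ⟨by rw [IsSymm, transpose_neg, h.1.eq], by rw [simplifiedRic_neg_neg, h.2]⟩

theorem isSimplifiedARESolution_neg_neg {D M X : Matrix ι ι ℝ} :
    IsSimplifiedARESolution (-D) M (-X) ↔ IsSimplifiedARESolution D M X :=
  ⟨fun h => by simpa using h.neg, fun h => h.neg⟩

theorem simplifiedRic_eq_zero_iff {D M X Y : Matrix ι ι ℝ} (hXY : X * Y = 1) :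
    simplifiedRic D M X = 0 ↔ Dᵀ * Y + Y * D = M := by
  have hYX : Y * X = 1 := mul_eq_one_comm.1 hXY
  -- This congruence by an invertible matrix is the linearisation.
  have h1 : simplifiedRic D M X = X * (M - (Dᵀ * Y + Y * D)) * X := by
    have e1 : X * (Dᵀ * Y) * X = X * Dᵀ := by
      rw [← Matrix.mul_assoc X, Matrix.mul_assoc, hYX, Matrix.mul_one]
    have e2 : X * (Y * D) * X = D * X := by
      rw [← Matrix.mul_assoc X, hXY, Matrix.one_mul]
    rw [simplifiedRic, Matrix.mul_sub, Matrix.sub_mul, Matrix.mul_add, Matrix.add_mul, e1, e2,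
      Matrix.neg_mul]
    abel
  refine ⟨fun h => ?_, fun h => by rw [h1, h, sub_self, Matrix.mul_zero, Matrix.zero_mul]⟩
  have h2 : M - (Dᵀ * Y + Y * D) = Y * simplifiedRic D M X * Y := by
    rw [h1, Matrix.mul_assoc X, ← Matrix.mul_assoc Y, hYX, Matrix.one_mul, Matrix.mul_assoc, hXY,
      Matrix.mul_one]
  rw [h, Matrix.mul_zero, Matrix.zero_mul] at h2
  exact (sub_eq_zero.1 h2).symm

theorem exists_posDef_isSimplifiedARESolution_iff {D M : Matrix ι ι ℝ} (hD : Antistable D)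
    (hM : M.PosSemidef) (hobs : Observable D M) :
    ∃ P : Matrix ι ι ℝ, P.PosDef ∧ (∀ Y, Dᵀ * Y + Y * D = M ↔ Y = P) ∧
      ∀ X, IsSimplifiedARESolution D M X ∧ IsUnit X ↔ X = P⁻¹ := by
  obtain ⟨P, hP⟩ := sylvester_surjective hD.neg_notMem M
  have hPD : P.PosDef := posDef_of_lyapunov_of_observable hD hM hobs hP
  have huniq : ∀ Y, Dᵀ * Y + Y * D = M ↔ Y = P := fun Y =>
    ⟨fun h => sylvester_injective hD.neg_notMem (Eq.trans h hP.symm), fun h => h ▸ hP⟩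
  have hdet : IsUnit P.det := (isUnit_iff_isUnit_det _).1 hPD.isUnit
  refine ⟨P, hPD, huniq, fun X => ⟨fun ⟨hX, hu⟩ => ?_, ?_⟩⟩
  · have hXd := (isUnit_iff_isUnit_det _).1 hu
    have := (huniq _).1 ((simplifiedRic_eq_zero_iff (mul_nonsing_inv X hXd)).1 hX.2)
    rw [← this, nonsing_inv_nonsing_inv X hXd]
  · rintro rfl
    exact ⟨⟨isSymm_of_isHermitian hPD.inv.isHermitian,
      (simplifiedRic_eq_zero_iff (nonsing_inv_mul P hdet)).2 hP⟩, hPD.inv.isUnit⟩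

/-- The closed loop of an invertible solution is similar to the transpose of the open loop. -/
theorem Antistable.closedLoop {D M X : Matrix ι ι ℝ} (hD : Antistable D)
    (hX : IsSimplifiedARESolution D M X) (hu : IsUnit X) : Antistable (X * M - D) := by
  have hXd := (isUnit_iff_isUnit_det _).1 hu
  have h : (X * M - D) * X = X * Dᵀ := by
    have := hX.2
    rw [simplifiedRic, Matrix.neg_mul] at this
    rw [Matrix.sub_mul, ← sub_eq_zero, ← this]
    abel
  rw [Antistable, eigenvalues_eq_of_conj (mul_nonsing_inv X hXd) (nonsing_inv_mul X hXd) h,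
    eigenvalues_transpose]
  exact hD

/-- With `Δ = K - Y` and `F = K M - D`, subtracting the two Riccati expressions gives `F Δ + Δ Fᵀ =
-Ric(Y) + Δ M Δ ≥ 0`, and Lyapunov's theorem for `Fᵀ` yields `Δ ≥ 0`. -/
theorem le_of_antistable {D M K Y : Matrix ι ι ℝ} (hM : M.PosSemidef)
    (hK : IsSimplifiedARESolution D M K) (hF : Antistable (K * M - D))
    (hY : IsSimplifiedARISolution D M Y) : Y ≤ K := by
  have hYs := hY.1
  have hYr := hY.2
  rw [le_iff, zero_sub] at hYr
  rw [le_iff]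
  have hΔ : (K - Y)ᴴ = K - Y := by
    rw [conjTranspose_eq_transpose_of_trivial, transpose_sub, hK.1.eq, hYs.eq]
  have hF' : Antistable (K * M - D)ᵀ := by rwa [Antistable, eigenvalues_transpose]
  have hMs := isSymm_of_isHermitian hM.isHermitian
  refine posSemidef_of_lyapunov hF' ?_
  have hq := hM.conjTranspose_mul_mul_same (K - Y)
  rw [hΔ] at hq
  have key : (K * M - D)ᵀᵀ * (K - Y) + (K - Y) * (K * M - D)ᵀ =
      -simplifiedRic D M Y + (K - Y) * M * (K - Y) := by
    have h0 := hK.2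
    rw [← sub_eq_zero, ← h0]
    simp only [simplifiedRic, transpose_sub, transpose_transpose, transpose_mul, hK.1.eq, hMs.eq,
      Matrix.sub_mul, Matrix.mul_sub, Matrix.neg_mul, Matrix.mul_assoc]
    abel
  rw [key]
  exact hYr.add hq

/-- The Riccati expression is invariant under changing the signs of both `D` and the unknown, which
reverses the order. -/
theorem ge_of_antistable {D M K Y : Matrix ι ι ℝ} (hM : M.PosSemidef)
    (hK : IsSimplifiedARESolution D M K) (hF : Antistable (D - K * M))
    (hY : IsSimplifiedARISolution D M Y) : K ≤ Y := by
  refine neg_le_neg_iff.1 (le_of_antistable hM hK.neg ?_ ⟨?_, ?_⟩)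
  · rwa [Matrix.neg_mul, sub_neg_eq_add, neg_add_eq_sub]
  · rw [IsSymm, transpose_neg, hY.1.eq]
  · rw [simplifiedRic_neg_neg]; exact hY.2

/-! ### Block diagonal open loop -/

section Blocks

variable {A : Matrix ι ι ℝ} {B : Matrix κ κ ℝ} {M : Matrix (ι ⊕ κ) (ι ⊕ κ) ℝ}

theorem Antistable.fromBlocks_zero₁₂ {C : Matrix κ ι ℝ} (hA : Antistable A) (hB : Antistable B) :
    Antistable (fromBlocks A 0 C B) :=
  fun μ hμ => (mem_eigenvalues_fromBlocks_zero₁₂.1 hμ).elim (hA μ) (hB μ)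

theorem Antistable.fromBlocks_zero₂₁ {C : Matrix ι κ ℝ} (hA : Antistable A) (hB : Antistable B) :
    Antistable (fromBlocks A C 0 B) :=
  fun μ hμ => (mem_eigenvalues_fromBlocks_zero₂₁.1 hμ).elim (hA μ) (hB μ)

theorem IsSimplifiedARESolution.fromBlocks₁₁ {X : Matrix ι ι ℝ}
    (h : IsSimplifiedARESolution A M.toBlocks₁₁ X) :
    IsSimplifiedARESolution (fromBlocks A 0 0 B) M (fromBlocks X 0 0 0) := by
  refine ⟨by simp [IsSymm, fromBlocks_transpose, h.1.eq], ?_⟩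
  have := h.2
  rw [simplifiedRic] at this ⊢
  nth_rewrite 1 [← fromBlocks_toBlocks M]
  simp [fromBlocks_neg, fromBlocks_multiply, fromBlocks_transpose, sub_eq_add_neg, fromBlocks_add]
  rw [sub_eq_add_neg, Matrix.neg_mul] at this
  rw [this, fromBlocks_zero]

theorem IsSimplifiedARESolution.fromBlocks₂₂ {X : Matrix κ κ ℝ}
    (h : IsSimplifiedARESolution B M.toBlocks₂₂ X) :
    IsSimplifiedARESolution (fromBlocks A 0 0 B) M (fromBlocks 0 0 0 X) := by
  refine ⟨by simp [IsSymm, fromBlocks_transpose, h.1.eq], ?_⟩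
  have := h.2
  rw [simplifiedRic] at this ⊢
  nth_rewrite 1 [← fromBlocks_toBlocks M]
  simp [fromBlocks_neg, fromBlocks_multiply, fromBlocks_transpose, sub_eq_add_neg, fromBlocks_add]
  rw [sub_eq_add_neg, Matrix.neg_mul] at this
  rw [this, fromBlocks_zero]

theorem mulVec_transpose_eq_zero_of_mulVec_eq_zero {D M X : Matrix ι ι ℝ}
    (h : simplifiedRic D M X = 0) {v : ι → ℝ} (hv : X *ᵥ v = 0) : X *ᵥ (Dᵀ *ᵥ v) = 0 := by
  have := congrArg (· *ᵥ v) h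
  simpa [simplifiedRic, add_mulVec, sub_mulVec, neg_mulVec, ← mulVec_mulVec, hv] using this

theorem mulVec_aeval_transpose_eq_zero {D M X : Matrix ι ι ℝ}
    (h : simplifiedRic D M X = 0) {v : ι → ℝ} (hv : X *ᵥ v = 0) (p : Polynomial ℝ) :
    X *ᵥ (Polynomial.aeval Dᵀ p *ᵥ v) = 0 := by
  induction p using Polynomial.induction_on' with
  | add p q hp hq => rw [map_add, add_mulVec, mulVec_add, hp, hq, add_zero]
  | monomial k a =>
    have hk : X *ᵥ (Dᵀ ^ k *ᵥ v) = 0 := by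
      induction k with
      | zero => simpa using hv
      | succ k ih =>
        rw [pow_succ', ← mulVec_mulVec]
        exact mulVec_transpose_eq_zero_of_mulVec_eq_zero h ih
    rw [Polynomial.aeval_monomial, Algebra.algebraMap_eq_smul_one, Matrix.smul_mul,
      Matrix.one_mul, smul_mulVec, mulVec_smul, hk, smul_zero]

theorem aeval_fromBlocks_diag (p : Polynomial ℝ) :
    Polynomial.aeval (fromBlocks A 0 0 B) p =
      fromBlocks (Polynomial.aeval A p) 0 0 (Polynomial.aeval B p) := by
  induction p using Polynomial.induction_on' with
  | add p q hp hq => simp [hp, hq, fromBlocks_add]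
  | monomial k a =>
    have hk : fromBlocks A 0 0 B ^ k = fromBlocks (A ^ k) 0 0 (B ^ k) := by
      induction k with
      | zero => simp
      | succ k ih => simp [pow_succ, ih, fromBlocks_multiply]
    simp [Polynomial.aeval_monomial, Algebra.algebraMap_eq_smul_one, hk, fromBlocks_smul]

theorem eq_zero_of_isUnit_mulVec {X : Matrix ι ι ℝ} (hX : IsUnit X) {v : ι → ℝ}
    (h : X *ᵥ v = 0) : v = 0 :=
  mulVec_injective_iff_isUnit.2 hX (h.trans (mulVec_zero X).symm)

/-- A solution with invertible diagonal blocks is invertible, since its kernel is spanned by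
its intersections with the two spectral subspaces. -/
theorem isUnit_of_isUnit_toBlocks (hAB : ∀ μ ∈ eigenvalues A, μ ∉ eigenvalues B)
    {L : Matrix (ι ⊕ κ) (ι ⊕ κ) ℝ} (hL : simplifiedRic (fromBlocks A 0 0 B) M L = 0)
    (h₁ : IsUnit L.toBlocks₁₁) (h₂ : IsUnit L.toBlocks₂₂) : IsUnit L := by
  rw [← mulVec_injective_iff_isUnit, ← coe_mulVecLin, injective_iff_map_eq_zero]
  intro v hv
  rw [mulVecLin_apply] at hv
  have hDt : (fromBlocks A 0 0 B)ᵀ = fromBlocks Aᵀ 0 0 Bᵀ := by simp [fromBlocks_transpose]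
  have hu : IsUnit (Polynomial.aeval Aᵀ Bᵀ.charpoly) := isUnit_aeval_charpoly fun μ hμ => by
    rw [eigenvalues_transpose] at hμ ⊢; exact hAB μ hμ
  -- The kernel is `Dᵀ`-invariant, and this polynomial in `Dᵀ` annihilates the second component
  -- while acting invertibly on the first.
  have hp := mulVec_aeval_transpose_eq_zero hL hv Bᵀ.charpoly
  obtain ⟨v₁, v₂, rfl⟩ : ∃ v₁ v₂, v = Sum.elim v₁ v₂ :=
    ⟨v ∘ Sum.inl, v ∘ Sum.inr, (Sum.elim_comp_inl_inr v).symm⟩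
  rw [hDt, aeval_fromBlocks_diag, aeval_self_charpoly, fromBlocks_mulVec,
    ← fromBlocks_toBlocks L, fromBlocks_mulVec] at hp
  have hp₁ : L.toBlocks₁₁ *ᵥ (Polynomial.aeval Aᵀ Bᵀ.charpoly *ᵥ v₁) = 0 := by
    ext i
    simpa using congrFun hp (Sum.inl i)
  have hv₁ : v₁ = 0 := eq_zero_of_isUnit_mulVec hu (eq_zero_of_isUnit_mulVec h₁ hp₁)
  subst hv₁
  rw [← fromBlocks_toBlocks L, fromBlocks_mulVec] at hv
  have hv₂ : v₂ = 0 := eq_zero_of_isUnit_mulVec h₂ <| by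
    ext i
    simpa using congrFun hv (Sum.inr i)
  subst hv₂
  ext i
  cases i <;> rfl

theorem lyapunov_fromBlocks_iff {X : Matrix (ι ⊕ κ) (ι ⊕ κ) ℝ} :
    (fromBlocks A 0 0 B)ᵀ * X + X * fromBlocks A 0 0 B = M ↔
      (Aᵀ * X.toBlocks₁₁ + X.toBlocks₁₁ * A = M.toBlocks₁₁ ∧
        Aᵀ * X.toBlocks₁₂ + X.toBlocks₁₂ * B = M.toBlocks₁₂) ∧
      Bᵀ * X.toBlocks₂₁ + X.toBlocks₂₁ * A = M.toBlocks₂₁ ∧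
        Bᵀ * X.toBlocks₂₂ + X.toBlocks₂₂ * B = M.toBlocks₂₂ := by
  nth_rewrite 1 2 [← fromBlocks_toBlocks X]
  nth_rewrite 1 [← fromBlocks_toBlocks M]
  rw [fromBlocks_transpose, fromBlocks_multiply, fromBlocks_multiply, fromBlocks_add,
    fromBlocks_inj]
  simp [and_assoc]

end Blocks

/-! ### Inverses of block matrices -/

section BlockInverse

variable {L X : Matrix (ι ⊕ κ) (ι ⊕ κ) ℝ}

theorem toBlocks_mul_eq_one_iff :
    L * X = 1 ↔
      (L.toBlocks₁₁ * X.toBlocks₁₁ + L.toBlocks₁₂ * X.toBlocks₂₁ = 1 ∧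
        L.toBlocks₁₁ * X.toBlocks₁₂ + L.toBlocks₁₂ * X.toBlocks₂₂ = 0) ∧
      L.toBlocks₂₁ * X.toBlocks₁₁ + L.toBlocks₂₂ * X.toBlocks₂₁ = 0 ∧
        L.toBlocks₂₁ * X.toBlocks₁₂ + L.toBlocks₂₂ * X.toBlocks₂₂ = 1 := by
  nth_rewrite 1 [← fromBlocks_toBlocks X, ← fromBlocks_toBlocks L]
  rw [fromBlocks_multiply, ← fromBlocks_one, fromBlocks_inj, and_assoc]

theorem isUnit_toBlocks₁₁_of_mul_eq_one (h : L * X = 1) (hX : IsUnit X.toBlocks₂₂) :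
    IsUnit L.toBlocks₁₁ := by
  obtain ⟨⟨h1, h2⟩, -⟩ := toBlocks_mul_eq_one_iff.1 h
  have hd := (isUnit_iff_isUnit_det _).1 hX
  have h3 : L.toBlocks₁₂ = -(L.toBlocks₁₁ * X.toBlocks₁₂ * X.toBlocks₂₂⁻¹) := by
    rw [← Matrix.neg_mul, ← eq_neg_of_add_eq_zero_right h2, mul_nonsing_inv_cancel_right _ _ hd]
  refine IsUnit.of_mul_eq_one (X.toBlocks₁₁ - X.toBlocks₁₂ * X.toBlocks₂₂⁻¹ * X.toBlocks₂₁) ?_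
  rw [← h1, h3, Matrix.mul_sub, Matrix.neg_mul, sub_eq_add_neg]
  simp only [Matrix.mul_assoc]

theorem isUnit_toBlocks₂₂_of_mul_eq_one (h : L * X = 1) (hX : IsUnit X.toBlocks₁₁) :
    IsUnit L.toBlocks₂₂ := by
  obtain ⟨-, h1, h2⟩ := toBlocks_mul_eq_one_iff.1 h
  have hd := (isUnit_iff_isUnit_det _).1 hX
  have h3 : L.toBlocks₂₁ = -(L.toBlocks₂₂ * X.toBlocks₂₁ * X.toBlocks₁₁⁻¹) := by
    rw [← Matrix.neg_mul, ← eq_neg_of_add_eq_zero_left h1, mul_nonsing_inv_cancel_right _ _ hd]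
  refine IsUnit.of_mul_eq_one (X.toBlocks₂₂ - X.toBlocks₂₁ * X.toBlocks₁₁⁻¹ * X.toBlocks₁₂) ?_
  rw [← h2, h3, Matrix.mul_sub, Matrix.neg_mul, sub_eq_neg_add]
  simp only [Matrix.mul_assoc]

/-- The first block column of `L X = 1` gives `L₂₁ X₁₁ = -L₂₂ X₂₁`; multiplying the Schur complement
by `X₁₁` then leaves `L₁₁ X₁₁ + L₁₂ X₂₁ = 1`. -/
theorem schur₂₂_eq_inv (h : L * X = 1) (hL : IsUnit L.toBlocks₂₂) :
    L.toBlocks₁₁ - L.toBlocks₁₂ * L.toBlocks₂₂⁻¹ * L.toBlocks₂₁ = X.toBlocks₁₁⁻¹ := by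
  obtain ⟨⟨h1, -⟩, h2, -⟩ := toBlocks_mul_eq_one_iff.1 h
  have hd := (isUnit_iff_isUnit_det _).1 hL
  refine (inv_eq_left_inv ?_).symm
  rw [Matrix.sub_mul, Matrix.mul_assoc, Matrix.mul_assoc, eq_neg_of_add_eq_zero_left h2,
    Matrix.mul_neg, nonsing_inv_mul_cancel_left _ _ hd, Matrix.mul_neg, sub_neg_eq_add, h1]

theorem schur₁₁_eq_inv (h : L * X = 1) (hL : IsUnit L.toBlocks₁₁) :
    L.toBlocks₂₂ - L.toBlocks₂₁ * L.toBlocks₁₁⁻¹ * L.toBlocks₁₂ = X.toBlocks₂₂⁻¹ := by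
  obtain ⟨⟨-, h2⟩, -, h1⟩ := toBlocks_mul_eq_one_iff.1 h
  have hd := (isUnit_iff_isUnit_det _).1 hL
  refine (inv_eq_left_inv ?_).symm
  rw [Matrix.sub_mul, Matrix.mul_assoc, Matrix.mul_assoc, eq_neg_of_add_eq_zero_right h2,
    Matrix.mul_neg, nonsing_inv_mul_cancel_left _ _ hd, Matrix.mul_neg, sub_neg_eq_add, add_comm,
    h1]

/-- For a kernel vector `(a, b)`, pairing the two rows with `a` and `b` cancels the `Y` terms and
leaves `aᵀ P a + bᵀ R b = 0`. -/
theorem isUnit_fromBlocks_neg_of_posDef {P : Matrix ι ι ℝ} {R : Matrix κ κ ℝ} (hP : P.PosDef)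
    (hR : R.PosDef) (Y : Matrix ι κ ℝ) : IsUnit (fromBlocks P Y Yᵀ (-R)) := by
  rw [← mulVec_injective_iff_isUnit, ← coe_mulVecLin, injective_iff_map_eq_zero]
  intro v hv
  obtain ⟨a, b, rfl⟩ : ∃ a b, v = Sum.elim a b :=
    ⟨v ∘ Sum.inl, v ∘ Sum.inr, (Sum.elim_comp_inl_inr v).symm⟩
  rw [mulVecLin_apply, fromBlocks_mulVec] at hv
  have h1 : P *ᵥ a + Y *ᵥ b = 0 := by
    ext i
    simpa using congrFun hv (Sum.inl i)
  have h2 : Yᵀ *ᵥ a - R *ᵥ b = 0 := by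
    ext i
    simpa [neg_mulVec, sub_eq_add_neg] using congrFun hv (Sum.inr i)
  have h3 : a ⬝ᵥ P *ᵥ a + b ⬝ᵥ R *ᵥ b = 0 := by
    rw [← sub_eq_zero.1 h2, eq_neg_of_add_eq_zero_left h1, dotProduct_neg, mulVec_transpose,
      dotProduct_comm b, ← dotProduct_mulVec, neg_add_cancel]
  have ha := hP.posSemidef.dotProduct_mulVec_nonneg a
  have hb := hR.posSemidef.dotProduct_mulVec_nonneg b
  rw [star_trivial] at ha hb
  have ha0 : a = 0 := by
    by_contra hne
    have := hP.dotProduct_mulVec_pos hne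
    rw [star_trivial] at this
    linarith
  have hb0 : b = 0 := by
    by_contra hne
    have := hR.dotProduct_mulVec_pos hne
    rw [star_trivial] at this
    linarith
  subst ha0 hb0
  ext i
  cases i <;> rfl

end BlockInverse

/-! ### The inhomogeneous equation -/

theorem ric_add_conj {n m : ℕ} {A A₀ Q K₀ : Matrix (Fin n) (Fin n) ℝ} {B : Matrix (Fin n) (Fin m) ℝ}
    (hK₀ : K₀.IsSymm) (hric : ric A B Q K₀ = 0) (hA : A₀ = A - B * Bᵀ * K₀)
    {S : Matrix (Fin n) ι ℝ} {D : Matrix ι ι ℝ} (hS : A₀ᵀ * S = S * D) (X : Matrix ι ι ℝ) :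
    ric A B Q (K₀ + S * X * Sᵀ) = S * simplifiedRic D (Sᵀ * B * Bᵀ * S) X * Sᵀ := by
  have hS' : Sᵀ * A₀ = Dᵀ * Sᵀ := by
    rw [← transpose_mul, ← hS, transpose_mul, transpose_transpose]
  have e1 : S * (D * X) * Sᵀ = A₀ᵀ * (S * X * Sᵀ) := by
    rw [← Matrix.mul_assoc S, ← hS]; simp only [Matrix.mul_assoc]
  have e2 : S * (X * Dᵀ) * Sᵀ = S * X * Sᵀ * A₀ := by
    rw [Matrix.mul_assoc _ Sᵀ, hS']; simp only [Matrix.mul_assoc]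
  have e3 : S * simplifiedRic D (Sᵀ * B * Bᵀ * S) X * Sᵀ =
      -(A₀ᵀ * (S * X * Sᵀ)) - S * X * Sᵀ * A₀ + S * X * Sᵀ * B * Bᵀ * (S * X * Sᵀ) := by
    rw [← e1, ← e2]
    simp only [simplifiedRic, Matrix.mul_add, Matrix.add_mul, Matrix.mul_sub, Matrix.sub_mul,
      Matrix.neg_mul, Matrix.mul_neg, Matrix.mul_assoc]
  rw [e3]
  generalize S * X * Sᵀ = Y
  rw [← sub_eq_zero, ← hric, hA]
  simp only [ric, transpose_sub, transpose_mul, transpose_transpose, hK₀.eq, Matrix.mul_add,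
    Matrix.add_mul, Matrix.mul_sub, Matrix.sub_mul, Matrix.neg_mul, Matrix.mul_assoc]
  abel

end Riccati

/-! ### The extremal solutions and their bounds -/

theorem theorem4 {n m k l : ℕ}
    -- the controllable pair; `A₀` has no zero or purely imaginary eigenvalue
    (A₀ : Matrix (Fin n) (Fin n) ℝ) (B : Matrix (Fin n) (Fin m) ℝ)
    (hctrl : Riccati.Controllable A₀ B)
    (hA₀ : ∀ μ ∈ Riccati.eigenvalues A₀, μ.re ≠ 0)
    -- `A₀ᵀ S = S D` with `S` invertible (inverse `T`) and `D = diag(Dr, Dl)`: the real Jordan form,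
    -- or any other real block diagonal form that separates the two open half planes
    (S : Matrix (Fin n) (Fin k ⊕ Fin l) ℝ) (T : Matrix (Fin k ⊕ Fin l) (Fin n) ℝ)
    (hST : S * T = 1) (hTS : T * S = 1)
    (Dr : Matrix (Fin k) (Fin k) ℝ) (Dl : Matrix (Fin l) (Fin l) ℝ)
    (hDr : ∀ μ ∈ Riccati.eigenvalues Dr, 0 < μ.re)
    (hDl : ∀ μ ∈ Riccati.eigenvalues Dl, μ.re < 0)
    (D : Matrix (Fin k ⊕ Fin l) (Fin k ⊕ Fin l) ℝ) (hD : D = Matrix.fromBlocks Dr 0 0 Dl)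
    (hS : A₀ᵀ * S = S * D)
    (M : Matrix (Fin k ⊕ Fin l) (Fin k ⊕ Fin l) ℝ) (hM : M = Sᵀ * B * Bᵀ * S) :
    ∃ (Lr : Matrix (Fin k) (Fin k) ℝ) (Ll : Matrix (Fin l) (Fin l) ℝ),
      -- `Lr` and `Ll` are the unique full rank solutions of the two reduced order equations
      (∀ X : Matrix (Fin k) (Fin k) ℝ,
        (Riccati.IsSimplifiedARESolution Dr M.toBlocks₁₁ X ∧ X.rank = k) ↔ X = Lr) ∧
      (∀ X : Matrix (Fin l) (Fin l) ℝ,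
        (Riccati.IsSimplifiedARESolution Dl M.toBlocks₂₂ X ∧ X.rank = l) ↔ X = Ll) ∧
      -- `diag(Lr, 0)` and `diag(0, Ll)` solve the simplified equation
      Riccati.IsSimplifiedARESolution D M (Matrix.fromBlocks Lr 0 0 0) ∧
      Riccati.IsSimplifiedARESolution D M (Matrix.fromBlocks 0 0 0 Ll) ∧
      -- they are the Schur complements of a maximal rank solution whenever these are defined,
      -- which is the case exactly when that solution is invertible
      (∀ Lstar : Matrix (Fin k ⊕ Fin l) (Fin k ⊕ Fin l) ℝ,
        Riccati.IsMaximalRankARESolution D M Lstar →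
          ((IsUnit Lstar.toBlocks₁₁ ∧ IsUnit Lstar.toBlocks₂₂) ↔ IsUnit Lstar) ∧
          (IsUnit Lstar.toBlocks₁₁ → IsUnit Lstar.toBlocks₂₂ →
            Riccati.schurRight Lstar = Matrix.fromBlocks Lr 0 0 0 ∧
            Riccati.schurLeft Lstar = Matrix.fromBlocks 0 0 0 Ll) ∧
          ((∀ μ ∈ Riccati.eigenvalues A₀, -μ ∉ Riccati.eigenvalues A₀) → IsUnit Lstar)) ∧
      -- they bound every solution of the simplified inequality
      (∀ Lhat : Matrix (Fin k ⊕ Fin l) (Fin k ⊕ Fin l) ℝ,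
        Riccati.IsSimplifiedARISolution D M Lhat →
          Matrix.fromBlocks 0 0 0 Ll ≤ Lhat ∧ Lhat ≤ Matrix.fromBlocks Lr 0 0 0) ∧
      -- the extremal solutions of the inhomogeneous inequality
      (∀ A Q K₀ : Matrix (Fin n) (Fin n) ℝ, Q.IsSymm → K₀.IsSymm →
        Riccati.ric A B Q K₀ = 0 → A₀ = A - B * Bᵀ * K₀ →
        ∃ Kmin Kmax : Matrix (Fin n) (Fin n) ℝ,
          Kmin = K₀ + S * (Matrix.fromBlocks 0 0 0 Ll : Matrix (Fin k ⊕ Fin l) (Fin k ⊕ Fin l) ℝ) * Sᵀ ∧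
          Kmax = K₀ + S * (Matrix.fromBlocks Lr 0 0 0 : Matrix (Fin k ⊕ Fin l) (Fin k ⊕ Fin l) ℝ) * Sᵀ ∧
          Riccati.ric A B Q Kmin = 0 ∧ Riccati.ric A B Q Kmax = 0 ∧
          ∀ K : Matrix (Fin n) (Fin n) ℝ, K.IsSymm → Riccati.ric A B Q K ≤ 0 →
            Kmin ≤ K ∧ K ≤ Kmax) := by
  subst hD hM
  have hM : (Sᵀ * B * Bᵀ * S).PosSemidef := by
    have := posSemidef_conjTranspose_mul_self (Bᵀ * S)
    rwa [conjTranspose_eq_transpose_of_trivial, transpose_mul, transpose_transpose,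
      ← Matrix.mul_assoc] at this
  have hobs := hctrl.observable hTS hS
  generalize hMdef : Sᵀ * B * Bᵀ * S = M at hM hobs ⊢
  have hMs := Riccati.isSymm_of_isHermitian hM.isHermitian
  have hDl' : Riccati.Antistable (-Dl) := fun μ hμ => by
    have := hDl _ (Riccati.mem_eigenvalues_neg.1 hμ)
    rw [Complex.neg_re] at this
    linarith
  have hM₁₁ : M.toBlocks₁₁.PosSemidef := hM.submatrix Sum.inl
  have hM₂₂ : M.toBlocks₂₂.PosSemidef := hM.submatrix Sum.inr
  obtain ⟨P, hP, hPu, hPs⟩ := Riccati.exists_posDef_isSimplifiedARESolution_iff hDr hM₁₁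
    (hobs.toBlocks₁₁ hM)
  obtain ⟨R, hR, hRu, hRs⟩ := Riccati.exists_posDef_isSimplifiedARESolution_iff hDl' hM₂₂
    (hobs.toBlocks₂₂ hM).neg
  have hRu' : ∀ Y, Dlᵀ * Y + Y * Dl = M.toBlocks₂₂ ↔ Y = -R := fun Y => by
    rw [← neg_eq_iff_eq_neg, ← hRu, transpose_neg, neg_mul_neg, neg_mul_neg]
  have hRs' : ∀ X, Riccati.IsSimplifiedARESolution Dl M.toBlocks₂₂ X ∧ IsUnit X ↔ X = -R⁻¹ :=
    fun X => by
      rw [← neg_eq_iff_eq_neg, ← hRs, Riccati.isSimplifiedARESolution_neg_neg, IsUnit.neg_iff]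
  obtain ⟨hLr, hLru⟩ := (hPs P⁻¹).2 rfl
  obtain ⟨hLl, hLlu⟩ := (hRs' (-R⁻¹)).2 rfl
  have hLrD : Riccati.IsSimplifiedARESolution (fromBlocks Dr 0 0 Dl) M (fromBlocks P⁻¹ 0 0 0) :=
    hLr.fromBlocks₁₁
  have hLlD : Riccati.IsSimplifiedARESolution (fromBlocks Dr 0 0 Dl) M (fromBlocks 0 0 0 (-R⁻¹)) :=
    hLl.fromBlocks₂₂
  have hbounds : ∀ Y, Riccati.IsSimplifiedARISolution (fromBlocks Dr 0 0 Dl) M Y →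
      fromBlocks 0 0 0 (-R⁻¹) ≤ Y ∧ Y ≤ fromBlocks P⁻¹ 0 0 0 := by
    -- Both closed loops are block triangular: one diagonal block is the closed loop of a reduced
    -- equation, the other is `Dr` or `-Dl`.
    refine fun Y hY => ⟨Riccati.ge_of_antistable hM hLlD ?_ hY,
      Riccati.le_of_antistable hM hLrD ?_ hY⟩
    · have h := hDl'.closedLoop hLl.neg hLlu.neg
      have hF : fromBlocks Dr 0 0 Dl - fromBlocks 0 0 0 (-R⁻¹) * M =
          fromBlocks Dr 0 (-(-R⁻¹ * M.toBlocks₂₁)) (- -R⁻¹ * M.toBlocks₂₂ - -Dl) := by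
        nth_rewrite 1 [← fromBlocks_toBlocks M]
        rw [fromBlocks_multiply, sub_eq_add_neg, fromBlocks_neg, fromBlocks_add]
        congr 1 <;> simp [add_comm, sub_eq_add_neg]
      rw [hF]
      exact Riccati.Antistable.fromBlocks_zero₁₂ hDr h
    · have h := Riccati.Antistable.closedLoop hDr hLr hLru
      have hF : fromBlocks P⁻¹ 0 0 0 * M - fromBlocks Dr 0 0 Dl =
          fromBlocks (P⁻¹ * M.toBlocks₁₁ - Dr) (P⁻¹ * M.toBlocks₁₂) 0 (-Dl) := by
        nth_rewrite 1 [← fromBlocks_toBlocks M]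
        rw [fromBlocks_multiply, sub_eq_add_neg, fromBlocks_neg, fromBlocks_add]
        congr 1 <;> simp [sub_eq_add_neg]
      rw [hF]
      exact Riccati.Antistable.fromBlocks_zero₂₁ h hDl'
  have hblocks : ∀ L X : Matrix (Fin k ⊕ Fin l) (Fin k ⊕ Fin l) ℝ,
      Riccati.simplifiedRic (fromBlocks Dr 0 0 Dl) M L = 0 → L * X = 1 →
        X.toBlocks₁₁ = P ∧ X.toBlocks₂₂ = -R := by
    intro L X hL hLX
    obtain ⟨⟨h1, -⟩, -, h2⟩ := Riccati.lyapunov_fromBlocks_iff.1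
      ((Riccati.simplifiedRic_eq_zero_iff hLX).1 hL)
    exact ⟨(hPu _).1 h1, (hRu' _).1 h2⟩
  have hsep : ∀ μ ∈ Riccati.eigenvalues Dr, μ ∉ Riccati.eigenvalues Dl := fun μ h1 h2 =>
    (hDr μ h1).not_gt (hDl μ h2)
  have hunit : ∀ L, Riccati.simplifiedRic (fromBlocks Dr 0 0 Dl) M L = 0 →
      ((IsUnit L.toBlocks₁₁ ∧ IsUnit L.toBlocks₂₂) ↔ IsUnit L) := by
    refine fun L hL => ⟨fun h => Riccati.isUnit_of_isUnit_toBlocks hsep hL h.1 h.2, fun h => ?_⟩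
    have hLX := mul_nonsing_inv L ((isUnit_iff_isUnit_det _).1 h)
    obtain ⟨h1, h2⟩ := hblocks L _ hL hLX
    exact ⟨Riccati.isUnit_toBlocks₁₁_of_mul_eq_one hLX (h2 ▸ hR.isUnit.neg),
      Riccati.isUnit_toBlocks₂₂_of_mul_eq_one hLX (h1 ▸ hP.isUnit)⟩
  refine ⟨P⁻¹, -R⁻¹, fun X => ?_, fun X => ?_, hLrD, hLlD, fun L hL => ⟨hunit L hL.1.2, ?_, ?_⟩,
    hbounds, ?_⟩
  · rw [← hPs, ← Riccati.rank_eq_card_iff_isUnit, Fintype.card_fin]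
  · rw [← hRs', ← Riccati.rank_eq_card_iff_isUnit, Fintype.card_fin]
  · intro h₁ h₂
    have hLX := mul_nonsing_inv L
      ((isUnit_iff_isUnit_det _).1 ((hunit L hL.1.2).1 ⟨h₁, h₂⟩))
    obtain ⟨h1, h2⟩ := hblocks L _ hL.1.2 hLX
    rw [Riccati.schurRight, Riccati.schurLeft, Riccati.schur₂₂_eq_inv hLX h₂,
      Riccati.schur₁₁_eq_inv hLX h₁, h1, h2]
    refine ⟨rfl, ?_⟩
    congr 1
    refine inv_eq_left_inv ?_
    rw [neg_mul_neg, nonsing_inv_mul _ ((isUnit_iff_isUnit_det _).1 hR.isUnit)]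
  · intro hμ
    have hA : Riccati.eigenvalues A₀ = Riccati.eigenvalues (fromBlocks Dr 0 0 Dl) := by
      rw [← Riccati.eigenvalues_transpose, Riccati.eigenvalues_eq_of_conj hST hTS hS]
    have hsyl : ∀ μ ∈ Riccati.eigenvalues Drᵀ, -μ ∉ Riccati.eigenvalues Dl := by
      intro μ h1 h2
      rw [Riccati.eigenvalues_transpose] at h1
      rw [hA] at hμ
      exact hμ μ (Riccati.mem_eigenvalues_fromBlocks_zero₁₂.2 (Or.inl h1))
        (Riccati.mem_eigenvalues_fromBlocks_zero₁₂.2 (Or.inr h2))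
    -- This `Y` completes `P` and `-R` to an invertible Lyapunov solution; its inverse solves the
    -- Riccati equation with full rank, so `L` must have full rank as well.
    obtain ⟨Y, hY⟩ := Riccati.sylvester_surjective hsyl M.toBlocks₁₂
    rw [Riccati.sylvester_apply] at hY
    have hXu := Riccati.isUnit_fromBlocks_neg_of_posDef hP hR Y
    have hXs : (fromBlocks P Y Yᵀ (-R)).IsSymm := by
      rw [IsSymm, fromBlocks_transpose, transpose_neg, transpose_transpose,
        (Riccati.isSymm_of_isHermitian hP.isHermitian).eq,
        (Riccati.isSymm_of_isHermitian hR.isHermitian).eq]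
    have hM₂₁ : M.toBlocks₁₂ᵀ = M.toBlocks₂₁ := congrArg toBlocks₂₁ hMs.eq
    have hX : (fromBlocks Dr 0 0 Dl)ᵀ * fromBlocks P Y Yᵀ (-R) +
        fromBlocks P Y Yᵀ (-R) * fromBlocks Dr 0 0 Dl = M := by
      rw [Riccati.lyapunov_fromBlocks_iff]
      refine ⟨⟨(hPu P).2 rfl, hY⟩, ?_, (hRu' _).2 rfl⟩
      rw [← hM₂₁, ← hY]
      simp [add_comm]
    have hXd := (isUnit_iff_isUnit_det _).1 hXu
    have hsol : Riccati.IsSimplifiedARESolution (fromBlocks Dr 0 0 Dl) M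
        (fromBlocks P Y Yᵀ (-R))⁻¹ :=
      ⟨by rw [IsSymm, transpose_nonsing_inv, hXs.eq],
        (Riccati.simplifiedRic_eq_zero_iff (nonsing_inv_mul _ hXd)).2 hX⟩
    have hrank := hL.2 _ hsol
    rw [Riccati.rank_eq_card_iff_isUnit.2 (isUnit_nonsing_inv_iff.2 hXu)] at hrank
    exact Riccati.rank_eq_card_iff_isUnit.1 (le_antisymm L.rank_le_card_width hrank)
  · intro A Q K₀ _ hK₀ hric hA
    have hconj := Riccati.ric_add_conj hK₀ hric hA hS
    rw [hMdef] at hconj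
    refine ⟨_, _, rfl, rfl, ?_, ?_, fun K hK hKr => ?_⟩
    · rw [hconj, hLlD.2, Matrix.mul_zero, Matrix.zero_mul]
    · rw [hconj, hLrD.2, Matrix.mul_zero, Matrix.zero_mul]
    have hTS' : Sᵀ * Tᵀ = 1 := by rw [← transpose_mul, hTS, transpose_one]
    have hST' : Tᵀ * Sᵀ = 1 := by rw [← transpose_mul, hST, transpose_one]
    -- Undoes the congruence by `S`, so that `K = K₀ + S X Sᵀ`.
    obtain ⟨X, hX⟩ : ∃ X, X = T * (K - K₀) * Tᵀ := ⟨_, rfl⟩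
    have hKX : K = K₀ + S * X * Sᵀ := by
      rw [hX, Matrix.mul_assoc T, ← Matrix.mul_assoc S, hST, Matrix.one_mul, Matrix.mul_assoc,
        hST', Matrix.mul_one, add_sub_cancel]
    have hmono : ∀ U V : Matrix (Fin k ⊕ Fin l) (Fin k ⊕ Fin l) ℝ, U ≤ V →
        K₀ + S * U * Sᵀ ≤ K₀ + S * V * Sᵀ := by
      intro U V hUV
      rw [le_iff] at hUV ⊢
      have := hUV.mul_mul_conjTranspose_same S
      rwa [conjTranspose_eq_transpose_of_trivial, Matrix.mul_sub, Matrix.sub_mul,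
        ← add_sub_add_left_eq_sub _ _ K₀] at this
    have hXr : Riccati.IsSimplifiedARISolution (fromBlocks Dr 0 0 Dl) M X := by
      refine ⟨?_, ?_⟩
      · rw [hX, IsSymm, transpose_mul, transpose_mul, transpose_transpose, transpose_sub, hK.eq,
          hK₀.eq, Matrix.mul_assoc]
      · rw [hKX, hconj, le_iff, zero_sub] at hKr
        rw [le_iff, zero_sub]
        have := hKr.mul_mul_conjTranspose_same T
        rwa [conjTranspose_eq_transpose_of_trivial, Matrix.mul_neg, Matrix.neg_mul,
          Matrix.mul_assoc S, ← Matrix.mul_assoc T, hTS, Matrix.one_mul, Matrix.mul_assoc, hTS',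
          Matrix.mul_one] at this
    obtain ⟨h1, h2⟩ := hbounds X hXr
    rw [hKX]
    exact ⟨hmono _ _ h1, hmono _ _ h2⟩
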